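/- Let $m\ge 1$, $\mathbb T^m=\mathbb R^m/2\pi\mathbb Z^m$, and for an integrable $f$ on $\mathbb T^m$ put $\widehat f(k)=(2\pi)^{-m}\int_{\mathbb T^m}f(t)e^{-i(k,t)}\,dt$, $k\in\mathbb Z^m$. For $1<p\le 2$ let $A_p(\mathbb T^m)$ be the space of integrable functions $f$ on $\mathbb T^m$ with $\widehat f\in l^p(\mathbb Z^m)$, and let $A(\mathbb T^m)=A_1(\mathbb T^m)$ be the space of continuous functions $f$ on $\mathbb T^m$ with $\widehat f\in l^1(\mathbb Z^m)$; the norm is $\|f\|_{A_p(\mathbb T^m)}=\big(\sum_{k\in\mathbb Z^m}|\widehat f(k)|^p\big)^{1/p}$. For a real function $\varphi$ on $\mathbb T^m$ let $\Lambda(\varphi,p)$ be the set of all $\lambda\in\mathbb R$ with $e^{i\lambda\varphi}\in A_p(\mathbb T^m)$. Let $0<\alpha\le 1$ and let $\varphi\in C^{1,\alpha}(\mathbb T^m)$ be a real function, i.e. $\varphi:\mathbb R^m\to\mathbb R$ is $2\pi$-periodic in each variable and differentiable, and $\sup_{|t_1-t_2|\le\delta}|\nabla\varphi(t_1)-\nabla\varphi(t_2)|=O(\delta^\alpha)$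 as $\delta\to+0$. Suppose that the gradient of $\varphi$ is nondegenerate, i.e. the set $\nabla\varphi(\mathbb T^m)\subset\mathbb R^m$ has positive Lebesgue measure. Then for every $p$ with $1\le p<1+\alpha$ there is a constant $c_p>0$, independent of $\lambda$, such that $$\|e^{i\lambda\varphi}\|_{A_p(\mathbb T^m)}\ \ge\ c_p\,|\lambda|^{m\left(\frac1p-\frac1{1+\alpha}\right)}\qquad\text{for all }\lambda\in\Lambda(\varphi,p).$$ In particular, there is a constant $c>0$, independent of $\lambda$, such that $\|e^{i\lambda\varphi}\|_{A(\mathbb T^m)}\ge c\,|\lambda|^{\frac{m\alpha}{1+\alpha}}$ for all $\lambda\in\Lambda(\varphi,1)$. -/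

import Mathlib

open scoped Gradient

noncomputable section

namespace BeurlingHelson

/-- A function on the torus `ℝ^m / 2πℤ^m`, viewed as a function on `ℝ^m` that is `2π`-periodic
in each variable. -/
def TorusPeriodic {m : ℕ} {β : Type*} (f : EuclideanSpace ℝ (Fin m) → β) : Prop :=
  ∀ j : Fin m, Function.Periodic f (EuclideanSpace.single j (2 * Real.pi))

/-- The cube `[0, 2π]^m`, with which the torus is identified for integration. -/
def cube (m : ℕ) : Set (EuclideanSpace ℝ (Fin m)) :=
  {t | ∀ j : Fin m, t j ∈ Set.Icc 0 (2 * Real.pi)}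

/-- The Fourier coefficient `(2π)^{-m} ∫ f(t) e^{-i(k,t)} dt`, for `k ∈ ℤ^m`. -/
def torusCoeff {m : ℕ} (f : EuclideanSpace ℝ (Fin m) → ℂ) (k : Fin m → ℤ) : ℂ :=
  (1 / (2 * (Real.pi : ℂ)) ^ m) *
    ∫ t in cube m, f t * Complex.exp (-(Complex.I * ∑ j, (k j : ℂ) * ((t j : ℝ) : ℂ)))

/-- Membership in `A_p(𝕋^m)`, `1 ≤ p ≤ 2`: integrable functions on the torus with Fourier
coefficients in `l^p`; for `p = 1` the functions are moreover required to be continuous. -/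
structure MemA {m : ℕ} (p : ℝ) (f : EuclideanSpace ℝ (Fin m) → ℂ) : Prop where
  periodic : TorusPeriodic f
  integrable : MeasureTheory.IntegrableOn f (cube m)
  continuous : p = 1 → Continuous f
  summable : Summable fun k : Fin m → ℤ => ‖torusCoeff f k‖ ^ p

/-- The norm of `A_p(𝕋^m)`, the `l^p` norm of the Fourier coefficients
(meaningful for members of `A_p(𝕋^m)`). -/
def normA {m : ℕ} (p : ℝ) (f : EuclideanSpace ℝ (Fin m) → ℂ) : ℝ :=
  (∑' k : Fin m → ℤ, ‖torusCoeff f k‖ ^ p) ^ (1 / p)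

/-- The function `e^{iλφ}`. -/
def expPhase {m : ℕ} (φ : EuclideanSpace ℝ (Fin m) → ℝ) (lam : ℝ) :
    EuclideanSpace ℝ (Fin m) → ℂ :=
  fun t => Complex.exp (Complex.I * ((lam : ℂ) * (φ t : ℂ)))

/-- `Λ(φ, p)`: the set of all real `λ` with `e^{iλφ} ∈ A_p(𝕋^m)`. -/
def Lam {m : ℕ} (φ : EuclideanSpace ℝ (Fin m) → ℝ) (p : ℝ) : Set ℝ :=
  {lam | MemA p (expPhase φ lam)}

/-- The Lipschitz condition of order `α`: the modulus of continuity
`ω(g, δ) = sup_{|x - y| ≤ δ} |g x - g y|` is `O(δ^α)` as `δ → 0+`. -/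
def LipOrder {E F : Type*} [SeminormedAddCommGroup E] [SeminormedAddCommGroup F]
    (α : ℝ) (g : E → F) : Prop :=
  ∃ C δ₀ : ℝ, 0 < δ₀ ∧
    ∀ δ : ℝ, 0 < δ → δ ≤ δ₀ → ∀ x y : E, ‖x - y‖ ≤ δ → ‖g x - g y‖ ≤ C * δ ^ α

/-- Real functions of class `C^{1,α}(𝕋^m)`: periodic, differentiable, with gradient satisfying
the Lipschitz condition of order `α`. -/
structure C1Alpha {m : ℕ} (α : ℝ) (φ : EuclideanSpace ℝ (Fin m) → ℝ) : Prop where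
  periodic : TorusPeriodic φ
  differentiable : Differentiable ℝ φ
  gradient_lip : LipOrder α (∇ φ)

/-- The gradient is nondegenerate: its range has positive Lebesgue measure. -/
def NondegenerateGradient {m : ℕ} (φ : EuclideanSpace ℝ (Fin m) → ℝ) : Prop :=
  0 < MeasureTheory.volume (Set.range (∇ φ))

end BeurlingHelson

end

open scoped Gradient

noncomputable section

namespace BeurlingHelson

open MeasureTheory

/-! Put `r = max(1, |λ|)`. On a box of radius `d ~ r^{-1/(1+α)}` about any point `s`, the Taylor
error of `λφ` is bounded by a small constant, so `e^{iλφ}` is close there to a unimodular constant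
times the character whose frequency `κ` is the rounding of `λ∇φ(s)`. Hence `e^{iλφ}` must have
noticeable Fourier coefficients within distance `O(1/d)` of each such `κ`.

To make this quantitative without cutting off, the local correlation is written as a global
inequality with penalty `(π²/d²) ∑ (1 - cos(t_j - s_j))` (`correlation_of_taylor`) and integrated
against `|Q|²`, where `Q` is a trigonometric polynomial of degree `~ 1/d` concentrated near `s`
(`sum_tent_sq_le_of_correlation`). The penalty costs at most half of the main term. The result
bounds below, by a multiple of `d^m`, a weighted average of `|f̂|` around `κ`.

Jensen's inequality and summation over a set `F` of such frequencies give `‖e^{iλφ}‖ ≥ c |F|^{1/p}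
d^m` (`card_rpow_le_normA`). Unit cubes centred at the frequencies `κ` cover `λ∇φ(𝕋^m)`, whose
measure is of order `|λ|^m`, so `F` can be taken of size `~ r^m`
(`NondegenerateGradient.exists_card_ge`). Altogether the norm is at least a multiple of `r^{m/p -
m/(1+α)}`. -/

/-- The character `e^{i(k,t)}` of the torus. -/
def torusChar {m : ℕ} (k : Fin m → ℤ) (t : EuclideanSpace ℝ (Fin m)) : ℂ :=
  Complex.exp (((∑ j, (k j : ℝ) * t j : ℝ) : ℂ) * Complex.I)

/-! ### Orthogonality of characters and pairing with squared trigonometric polynomials. -/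

section Characters

variable {m : ℕ}

lemma torusChar_add (k l : Fin m → ℤ) (t : EuclideanSpace ℝ (Fin m)) :
    torusChar (k + l) t = torusChar k t * torusChar l t := by
  rw [torusChar, torusChar, torusChar, ← Complex.exp_add, ← add_mul, ← Complex.ofReal_add,
    ← Finset.sum_add_distrib]
  simp [add_mul]

lemma norm_torusChar (k : Fin m → ℤ) (t : EuclideanSpace ℝ (Fin m)) : ‖torusChar k t‖ = 1 :=
  Complex.norm_exp_ofReal_mul_I _

lemma torusChar_neg (k : Fin m → ℤ) (t : EuclideanSpace ℝ (Fin m)) :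
    torusChar (-k) t = (starRingEnd ℂ) (torusChar k t) := by
  rw [torusChar, torusChar, ← Complex.exp_conj]
  simp

lemma torusChar_sub_right (k : Fin m → ℤ) (t s : EuclideanSpace ℝ (Fin m)) :
    torusChar k (t - s) = torusChar (-k) s * torusChar k t := by
  rw [torusChar, torusChar, torusChar, ← Complex.exp_add, ← add_mul, ← Complex.ofReal_add,
    ← Finset.sum_add_distrib]
  congr 3
  exact Finset.sum_congr rfl fun j _ => by simp; ring

@[fun_prop]
lemma continuous_torusChar (k : Fin m → ℤ) :
    Continuous (torusChar k : EuclideanSpace ℝ (Fin m) → ℂ) := by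
  unfold torusChar
  fun_prop

lemma cube_eq_preimage :
    cube m = (WithLp.ofLp : EuclideanSpace ℝ (Fin m) → Fin m → ℝ) ⁻¹'
      Set.pi Set.univ fun _ => Set.Icc 0 (2 * Real.pi) := by
  ext t
  simp only [cube, Set.mem_ofPred_eq, Set.mem_preimage, Set.mem_univ_pi]

lemma isCompact_cube : IsCompact (cube m) := by
  rw [cube_eq_preimage]
  exact (PiLp.homeomorph 2 (fun _ : Fin m => ℝ)).isCompact_preimage.2
    (isCompact_univ_pi fun _ => isCompact_Icc)

lemma integrableOn_cube {E : Type*} [NormedAddCommGroup E] {f : EuclideanSpace ℝ (Fin m) → E}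
    (hf : Continuous f) : IntegrableOn f (cube m) :=
  hf.continuousOn.integrableOn_compact isCompact_cube

lemma integral_exp_int (n : ℤ) :
    ∫ s in Set.Icc 0 (2 * Real.pi), Complex.exp (((n : ℝ) * s : ℝ) * Complex.I) =
      if n = 0 then (2 * Real.pi : ℂ) else 0 := by
  rw [integral_Icc_eq_integral_Ioc, ← intervalIntegral.integral_of_le Real.two_pi_pos.le]
  split_ifs with h
  · simp [h]
  · have hc : ((n : ℂ) * Complex.I) ≠ 0 := mul_ne_zero (by exact_mod_cast h) Complex.I_ne_zero
    have h1 : ∀ s : ℝ, Complex.exp (((n : ℝ) * s : ℝ) * Complex.I) =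
        Complex.exp ((n : ℂ) * Complex.I * s) := fun s => by push_cast; ring_nf
    simp_rw [h1]
    rw [integral_exp_mul_complex hc]
    have h2 : (n : ℂ) * Complex.I * ((2 * Real.pi : ℝ) : ℂ) = n * (2 * Real.pi * Complex.I) := by
      push_cast; ring
    rw [h2, Complex.exp_int_mul_two_pi_mul_I]
    simp

lemma integral_torusChar (k : Fin m → ℤ) :
    ∫ t in cube m, torusChar k t = if k = 0 then (2 * Real.pi : ℂ) ^ m else 0 := by
  have hchar : ∀ t : EuclideanSpace ℝ (Fin m), torusChar k t =
      (fun x : Fin m → ℝ => ∏ j, Complex.exp (((k j : ℝ) * x j : ℝ) * Complex.I)) t.ofLp := by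
    intro t
    simp only [torusChar, ← Complex.exp_sum, ← Finset.sum_mul]
    push_cast
    rfl
  rw [integral_congr_ae (.of_forall hchar), cube_eq_preimage,
    (PiLp.volume_preserving_ofLp (Fin m)).setIntegral_preimage_emb
    (MeasurableEquiv.toLp 2 (Fin m → ℝ)).symm.measurableEmbedding
    (fun x : Fin m → ℝ => ∏ j, Complex.exp (((k j : ℝ) * x j : ℝ) * Complex.I)), volume_pi,
    Measure.restrict_pi_pi,
    integral_fintype_prod_eq_prod (fun (j : Fin m) (s : ℝ) =>
      Complex.exp (((k j : ℝ) * s : ℝ) * Complex.I))]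
  simp_rw [integral_exp_int]
  split_ifs with h
  · simp [h]
  · obtain ⟨j, hj⟩ := Function.ne_iff.1 h
    exact Finset.prod_eq_zero (Finset.mem_univ j) (if_neg hj)

lemma integral_norm_sq_trigPoly (S : Finset (Fin m → ℤ)) (c : (Fin m → ℤ) → ℂ) :
    ∫ t in cube m, ‖∑ A ∈ S, c A * torusChar A t‖ ^ 2 =
      (2 * Real.pi) ^ m * ∑ A ∈ S, ‖c A‖ ^ 2 := by
  apply Complex.ofReal_injective
  rw [← integral_complex_ofReal]
  have hexp : ∀ t : EuclideanSpace ℝ (Fin m),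
      ((‖∑ A ∈ S, c A * torusChar A t‖ ^ 2 : ℝ) : ℂ) =
        ∑ A ∈ S, ∑ B ∈ S, c A * (starRingEnd ℂ) (c B) * torusChar (A - B) t := by
    intro t
    rw [Complex.ofReal_pow, ← Complex.mul_conj', map_sum, Finset.sum_mul_sum]
    refine Finset.sum_congr rfl fun A _ => Finset.sum_congr rfl fun B _ => ?_
    rw [sub_eq_add_neg, torusChar_add, torusChar_neg, map_mul]
    ring
  simp_rw [hexp]
  rw [integral_finsetSum _ fun A _ => integrableOn_cube (by fun_prop)]
  simp_rw [fun A => integral_finsetSum (μ := volume.restrict (cube m)) S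
    (f := fun B t => c A * (starRingEnd ℂ) (c B) * torusChar (A - B) t)
    fun B _ => integrableOn_cube (by fun_prop), integral_const_mul, integral_torusChar, sub_eq_zero]
  push_cast
  rw [Finset.mul_sum]
  refine Finset.sum_congr rfl fun A hA => ?_
  rw [Finset.sum_eq_single A (by intro B _ hB; simp [hB.symm]) (by simp [hA]), if_pos rfl,
    Complex.mul_conj']
  ring

lemma torusCoeff_eq (f : EuclideanSpace ℝ (Fin m) → ℂ) (k : Fin m → ℤ) :
    ∫ t in cube m, f t * torusChar (-k) t = (2 * Real.pi : ℂ) ^ m * torusCoeff f k := by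
  have h : ∀ t : EuclideanSpace ℝ (Fin m), torusChar (-k) t =
      Complex.exp (-(Complex.I * ∑ j, (k j : ℂ) * ((t j : ℝ) : ℂ))) := by
    intro t
    rw [torusChar]
    congr 1
    push_cast
    simp [mul_comm]
  have hpi : (2 * Real.pi : ℂ) ^ m ≠ 0 := by
    simp [Real.pi_ne_zero]
  simp_rw [h, torusCoeff]
  field_simp

/-- Expanding the square produces the coefficients of `f` at `κ + (B - A)`. The triangle inequality
discards the phases of `c`, so the bound will not depend on where the kernel is centred. -/
lemma norm_integral_mul_kernel_le {f : EuclideanSpace ℝ (Fin m) → ℂ} (hf : Continuous f)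
    (S : Finset (Fin m → ℤ)) (c : (Fin m → ℤ) → ℂ) (κ : Fin m → ℤ) :
    ‖∫ t in cube m, f t * torusChar (-κ) t * ((‖∑ A ∈ S, c A * torusChar A t‖ ^ 2 : ℝ) : ℂ)‖ ≤
      (2 * Real.pi) ^ m *
        ∑ A ∈ S, ∑ B ∈ S, ‖c A‖ * ‖c B‖ * ‖torusCoeff f (κ + (B - A))‖ := by
  have hexp : ∀ t : EuclideanSpace ℝ (Fin m),
      f t * torusChar (-κ) t * ((‖∑ A ∈ S, c A * torusChar A t‖ ^ 2 : ℝ) : ℂ) =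
        ∑ A ∈ S, ∑ B ∈ S, c A * (starRingEnd ℂ) (c B) *
          (f t * torusChar (-(κ + (B - A))) t) := by
    intro t
    rw [Complex.ofReal_pow, ← Complex.mul_conj', map_sum, Finset.sum_mul_sum, Finset.mul_sum]
    refine Finset.sum_congr rfl fun A _ => ?_
    rw [Finset.mul_sum]
    refine Finset.sum_congr rfl fun B _ => ?_
    rw [show -(κ + (B - A)) = -κ + A + -B by abel, torusChar_add, torusChar_add,
      torusChar_neg B, map_mul]
    ring
  simp_rw [hexp]
  rw [integral_finsetSum _ fun A _ => integrableOn_cube (by fun_prop)]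
  simp_rw [fun A => integral_finsetSum (μ := volume.restrict (cube m)) S
    (f := fun B t => c A * (starRingEnd ℂ) (c B) * (f t * torusChar (-(κ + (B - A))) t))
    fun B _ => integrableOn_cube (by fun_prop), integral_const_mul, torusCoeff_eq]
  rw [Finset.mul_sum]
  refine (norm_sum_le _ _).trans (Finset.sum_le_sum fun A _ => ?_)
  rw [Finset.mul_sum]
  refine (norm_sum_le _ _).trans (Finset.sum_le_sum fun B _ => ?_)
  simp only [norm_mul, norm_pow, RCLike.norm_conj, Complex.norm_real, Complex.norm_ofNat,
    Real.norm_of_nonneg Real.pi_pos.le]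
  apply le_of_eq
  ring

end Characters

/-! ### A nonnegative kernel concentrated near a point. -/

/-- The trigonometric polynomial with real coefficients `W` on `S`, centred at `s`. -/
def centredPoly {m : ℕ} (S : Finset (Fin m → ℤ)) (W : (Fin m → ℤ) → ℝ)
    (s t : EuclideanSpace ℝ (Fin m)) : ℂ :=
  ∑ A ∈ S, (W A * torusChar (-A) s) * torusChar A t

/-- Tent-shaped weights of height and radius `2 * M` on the integer lattice. -/
def tent {m : ℕ} (M : ℕ) (A : Fin m → ℤ) : ℝ := max 0 (2 * M - ‖A‖)

/-- A lattice box containing the support of `tent M` and its translates by unit vectors. -/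
def tentBox (m M : ℕ) : Finset (Fin m → ℤ) :=
  Finset.Icc (fun _ => -(2 * M + 1 : ℤ)) (fun _ => 2 * M + 1)

section Kernel

variable {m : ℕ}

lemma centredPoly_eq (S : Finset (Fin m → ℤ)) (W : (Fin m → ℤ) → ℝ)
    (s t : EuclideanSpace ℝ (Fin m)) :
    centredPoly S W s t = ∑ A ∈ S, W A * torusChar A (t - s) :=
  Finset.sum_congr rfl fun A _ => by rw [torusChar_sub_right, mul_assoc]

@[fun_prop]
lemma continuous_centredPoly (S : Finset (Fin m → ℤ)) (W : (Fin m → ℤ) → ℝ)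
    (s : EuclideanSpace ℝ (Fin m)) : Continuous (centredPoly S W s) := by
  unfold centredPoly
  fun_prop

lemma integral_norm_sq_centredPoly (S : Finset (Fin m → ℤ)) (W : (Fin m → ℤ) → ℝ)
    (s : EuclideanSpace ℝ (Fin m)) :
    ∫ t in cube m, ‖centredPoly S W s t‖ ^ 2 = (2 * Real.pi) ^ m * ∑ A ∈ S, W A ^ 2 := by
  unfold centredPoly
  rw [integral_norm_sq_trigPoly]
  simp [norm_torusChar]

lemma torusChar_single (j : Fin m) (t : EuclideanSpace ℝ (Fin m)) :
    torusChar (Pi.single j 1) t = Complex.exp ((t j : ℂ) * Complex.I) := by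
  simp [torusChar, Pi.single_apply]

lemma one_sub_cos_eq (x : ℝ) :
    1 - Real.cos x = ‖1 - Complex.exp ((x : ℂ) * Complex.I)‖ ^ 2 / 2 := by
  rw [← Complex.normSq_eq_norm_sq, Complex.normSq_apply]
  simp only [Complex.sub_re, Complex.sub_im, Complex.one_re, Complex.one_im,
    Complex.exp_ofReal_mul_I_re, Complex.exp_ofReal_mul_I_im]
  nlinarith [Real.sin_sq_add_cos_sq x]

/-- Multiplying by a character shifts coefficients. The two vanishing conditions turn both finite
sums into sums over the whole lattice, where the shift is a reindexing. -/
lemma sum_shift_torusChar {S : Finset (Fin m → ℤ)} {W : (Fin m → ℤ) → ℝ} {e : Fin m → ℤ}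
    (hW : ∀ A ∉ S, W A = 0) (hWe : ∀ A ∉ S, W (A - e) = 0) (t : EuclideanSpace ℝ (Fin m)) :
    ∑ A ∈ S, (W (A - e) : ℂ) * torusChar A t =
      torusChar e t * ∑ A ∈ S, (W A : ℂ) * torusChar A t := by
  rw [Finset.mul_sum, ← tsum_eq_sum (L := .unconditional _) (s := S) (f := fun A => (W (A - e) : ℂ) * torusChar A t)
    (fun A hA => by simp [hWe A hA]), ← tsum_eq_sum (L := .unconditional _) (s := S)
    (f := fun A => torusChar e t * ((W A : ℂ) * torusChar A t)) (fun A hA => by simp [hW A hA]),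
    ← (Equiv.subRight e).tsum_eq (fun A => torusChar e t * ((W A : ℂ) * torusChar A t))]
  refine tsum_congr fun A => ?_
  have h : torusChar A t = torusChar e t * torusChar (A - e) t := by
    rw [← torusChar_add, add_sub_cancel]
  rw [h, Equiv.subRight_apply]
  ring

/-- Since `1 - cos x = |1 - e^{ix}|² / 2`, the extra factor replaces the coefficients by their
differences in direction `j`, and Parseval yields a discrete Dirichlet energy. -/
lemma integral_norm_sq_centredPoly_mul_one_sub_cos {S : Finset (Fin m → ℤ)}
    {W : (Fin m → ℤ) → ℝ} {j : Fin m} (hW : ∀ A ∉ S, W A = 0)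
    (hWe : ∀ A ∉ S, W (A - Pi.single j 1) = 0) (s : EuclideanSpace ℝ (Fin m)) :
    ∫ t in cube m, ‖centredPoly S W s t‖ ^ 2 * (1 - Real.cos (t j - s j)) =
      (2 * Real.pi) ^ m * ∑ A ∈ S, (W A - W (A - Pi.single j 1)) ^ 2 / 2 := by
  have h : ∀ t : EuclideanSpace ℝ (Fin m),
      ‖centredPoly S W s t‖ ^ 2 * (1 - Real.cos (t j - s j)) =
        ‖centredPoly S (fun A => W A - W (A - Pi.single j 1)) s t‖ ^ 2 / 2 := by
    intro t
    have h1 := sum_shift_torusChar hW hWe (t - s)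
    rw [one_sub_cos_eq, mul_div_assoc', ← mul_pow, ← norm_mul, centredPoly_eq, centredPoly_eq]
    congr 3
    rw [← PiLp.sub_apply, ← torusChar_single, mul_sub, mul_one, mul_comm _ (torusChar _ _), ← h1,
      ← Finset.sum_sub_distrib]
    exact Finset.sum_congr rfl fun A _ => by push_cast; ring
  simp_rw [h]
  rw [integral_div, integral_norm_sq_centredPoly, mul_div_assoc, Finset.sum_div]

lemma tent_nonneg (M : ℕ) (A : Fin m → ℤ) : 0 ≤ tent M A := le_max_left _ _

lemma norm_single_one_le (j : Fin m) : ‖(Pi.single j 1 : Fin m → ℤ)‖ ≤ 1 := by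
  rw [pi_norm_le_iff_of_nonneg zero_le_one]
  intro i
  by_cases h : i = j
  · subst h; simp
  · simp [h]

lemma lt_norm_of_notMem_tentBox {M : ℕ} {A : Fin m → ℤ} (hA : A ∉ tentBox m M) :
    (2 * M + 1 : ℝ) ≤ ‖A‖ := by
  by_contra! h
  apply hA
  have h1 : ∀ j, |A j| ≤ 2 * M + 1 := fun j => by
    have h2 : ‖A j‖ ≤ 2 * M + 1 := (norm_le_pi_norm A j).trans h.le
    rw [Int.norm_eq_abs] at h2
    exact_mod_cast h2
  exact Finset.mem_Icc.2 ⟨fun j => (abs_le.1 (h1 j)).1, fun j => (abs_le.1 (h1 j)).2⟩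

lemma tent_eq_zero {M : ℕ} {A : Fin m → ℤ} (hA : (2 * M : ℝ) ≤ ‖A‖) : tent M A = 0 :=
  max_eq_left (by linarith)

lemma tent_eq_zero_of_notMem {M : ℕ} {A : Fin m → ℤ} (hA : A ∉ tentBox m M) : tent M A = 0 :=
  tent_eq_zero (by linarith [lt_norm_of_notMem_tentBox hA])

lemma tent_sub_single_eq_zero_of_notMem {M : ℕ} {A : Fin m → ℤ} (hA : A ∉ tentBox m M)
    (j : Fin m) : tent M (A - Pi.single j 1) = 0 := by
  apply tent_eq_zero
  have := norm_sub_norm_le A (Pi.single j 1)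
  linarith [lt_norm_of_notMem_tentBox hA, norm_single_one_le j]

lemma card_tentBox (m M : ℕ) : (tentBox m M).card = (4 * M + 3) ^ m := by
  have h : (2 * (M : ℤ) + 1 + 1 - -(2 * M + 1)).toNat = 4 * M + 3 := by omega
  rw [tentBox, Pi.card_Icc]
  simp only [Int.card_Icc, Finset.prod_const, Finset.card_univ, Fintype.card_fin, h]

lemma sq_mul_pow_le_sum_tent_sq (m M : ℕ) :
    (M : ℝ) ^ 2 * (2 * M + 1) ^ m ≤ ∑ A ∈ tentBox m M, tent M A ^ 2 := by
  have h : ((M : ℤ) + 1 - -M).toNat = 2 * M + 1 := by omega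
  have hcard : (Finset.Icc (fun _ : Fin m => -(M : ℤ)) (fun _ => M)).card = (2 * M + 1) ^ m := by
    rw [Pi.card_Icc]
    simp only [Int.card_Icc, Finset.prod_const, Finset.card_univ, Fintype.card_fin, h]
  have hsub : Finset.Icc (fun _ : Fin m => -(M : ℤ)) (fun _ => M) ⊆ tentBox m M :=
    Finset.Icc_subset_Icc (fun j => by simp; omega) (fun j => by simp; omega)
  refine le_trans ?_ (Finset.sum_le_sum_of_subset_of_nonneg hsub fun A _ _ => sq_nonneg _)
  refine le_trans (le_of_eq ?_) (Finset.card_nsmul_le_sum _ _ ((M : ℝ) ^ 2) fun A hA => ?_)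
  · rw [hcard, nsmul_eq_mul]
    push_cast
    ring
  · have hnorm : ‖A‖ ≤ M := by
      rw [pi_norm_le_iff_of_nonneg (Nat.cast_nonneg M)]
      intro j
      rw [Int.norm_eq_abs]
      have := Finset.mem_Icc.1 hA
      exact_mod_cast abs_le.2 ⟨this.1 j, this.2 j⟩
    have : (M : ℝ) ≤ tent M A := le_max_of_le_right (by linarith)
    gcongr

lemma sum_tent_sub_sq_le (m M : ℕ) (j : Fin m) :
    ∑ A ∈ tentBox m M, (tent M A - tent M (A - Pi.single j 1)) ^ 2 / 2 ≤
      (4 * M + 3 : ℝ) ^ m / 2 := by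
  have h : ∀ A ∈ tentBox m M,
      (tent M A - tent M (A - Pi.single j 1)) ^ 2 / 2 ≤ (1 / 2 : ℝ) := by
    intro A _
    have h1 : |tent M A - tent M (A - Pi.single j 1)| ≤ 1 := by
      rw [tent, tent, max_comm 0, max_comm 0]
      refine (abs_max_sub_max_le_abs _ _ _).trans ?_
      rw [sub_sub_sub_cancel_left]
      refine (abs_norm_sub_norm_le _ _).trans ?_
      simpa using norm_single_one_le j
    have := (sq_le_one_iff_abs_le_one _).2 h1
    linarith
  refine (Finset.sum_le_card_nsmul (tentBox m M) _ (1 / 2 : ℝ) h).trans (le_of_eq ?_)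
  rw [card_tentBox, nsmul_eq_mul]
  push_cast
  ring

/-- Concentration at scale `1/M`: the tent is 1-Lipschitz, so its energy is at most half the number
of points in the box, while its squared mass is at least `M²` times the number of points with `‖A‖ ≤
M`. The factor `3 ^ m` compares the two boxes. -/
lemma integral_tent_kernel_le {M : ℕ} (hM : 1 ≤ M) (j : Fin m) (s : EuclideanSpace ℝ (Fin m)) :
    ∫ t in cube m, ‖centredPoly (tentBox m M) (tent M) s t‖ ^ 2 * (1 - Real.cos (t j - s j)) ≤
      3 ^ m / (2 * M ^ 2) * ((2 * Real.pi) ^ m * ∑ A ∈ tentBox m M, tent M A ^ 2) := by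
  rw [integral_norm_sq_centredPoly_mul_one_sub_cos (fun A => tent_eq_zero_of_notMem)
    (fun A hA => tent_sub_single_eq_zero_of_notMem hA j), mul_left_comm]
  refine mul_le_mul_of_nonneg_left ((sum_tent_sub_sq_le m M j).trans ?_) (by positivity)
  have hM' : (0 : ℝ) < M := by exact_mod_cast hM
  calc (4 * M + 3 : ℝ) ^ m / 2 ≤ (3 * (2 * M + 1)) ^ m / 2 := by gcongr; linarith
    _ = 3 ^ m / (2 * M ^ 2) * (M ^ 2 * (2 * M + 1) ^ m) := by
      rw [mul_pow]; field_simp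
    _ ≤ _ := by gcongr; exact sq_mul_pow_le_sum_tent_sq m M

/-! ### From local correlation to a lower bound for the norm. -/

/-- If `f` correlates with the character `κ` near `s`, then the Fourier coefficients of `f` near
`κ` are not all small. -/
lemma sum_tent_sq_le_of_correlation {f : EuclideanSpace ℝ (Fin m) → ℂ} (hf : Continuous f)
    {κ : Fin m → ℤ} {ω : ℂ} (hω : ‖ω‖ = 1) {s : EuclideanSpace ℝ (Fin m)} {D : ℝ} (hD : 0 ≤ D)
    (hcor : ∀ t : EuclideanSpace ℝ (Fin m),
      1 / 2 - D * ∑ j, (1 - Real.cos (t j - s j)) ≤ (ω * (f t * torusChar (-κ) t)).re)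
    {M : ℕ} (hM : 1 ≤ M) (hDM : 2 * D * m * 3 ^ m ≤ M ^ 2) :
    1 / 4 * ∑ A ∈ tentBox m M, tent M A ^ 2 ≤
      ∑ A ∈ tentBox m M, ∑ B ∈ tentBox m M,
        tent M A * tent M B * ‖torusCoeff f (κ + (B - A))‖ := by
  set Q := centredPoly (tentBox m M) (tent M) s with hQ
  have hQc : Continuous Q := continuous_centredPoly _ _ _
  set T := ∑ A ∈ tentBox m M, tent M A ^ 2 with hT
  have hT0 : 0 ≤ T := Finset.sum_nonneg fun A _ => sq_nonneg _
  have hM' : (0 : ℝ) < M := by exact_mod_cast hM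
  have hpi : (0 : ℝ) < (2 * Real.pi) ^ m := by positivity
  have hupper := norm_integral_mul_kernel_le hf (tentBox m M)
    (fun A => tent M A * torusChar (-A) s) κ
  simp only [norm_mul, norm_torusChar, mul_one, Complex.norm_real,
    Real.norm_of_nonneg (tent_nonneg M _)] at hupper
  change ‖∫ t in cube m, f t * torusChar (-κ) t * ((‖Q t‖ ^ 2 : ℝ) : ℂ)‖ ≤ _ at hupper
  set I := ∫ t in cube m, f t * torusChar (-κ) t * ((‖Q t‖ ^ 2 : ℝ) : ℂ) with hI
  have hre : ∫ t in cube m, (ω * (f t * torusChar (-κ) t)).re * ‖Q t‖ ^ 2 ≤ ‖I‖ := by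
    have h1 : (ω * I).re ≤ ‖I‖ := by
      calc (ω * I).re ≤ ‖ω * I‖ := Complex.re_le_norm _
        _ = ‖I‖ := by rw [norm_mul, hω, one_mul]
    refine le_trans (le_of_eq ?_) h1
    rw [hI, ← integral_const_mul]
    have h2 := integral_re (𝕜 := ℂ) (μ := volume.restrict (cube m))
      (f := fun t => ω * (f t * torusChar (-κ) t * ((‖Q t‖ ^ 2 : ℝ) : ℂ)))
      (integrableOn_cube (by fun_prop))
    refine Eq.trans ?_ h2
    refine integral_congr_ae (.of_forall fun t => ?_)
    simp only [RCLike.re_to_complex]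
    rw [← Complex.re_mul_ofReal, mul_assoc]
  have hlow : ∫ t in cube m,
      ((1 / 2) * ‖Q t‖ ^ 2 - D * ∑ j, ‖Q t‖ ^ 2 * (1 - Real.cos (t j - s j))) ≤
        ∫ t in cube m, (ω * (f t * torusChar (-κ) t)).re * ‖Q t‖ ^ 2 := by
    refine integral_mono (integrableOn_cube (by fun_prop)) (integrableOn_cube ?_) fun t => ?_
    · exact (Complex.continuous_re.comp (by fun_prop)).mul (by fun_prop)
    · have := mul_le_mul_of_nonneg_right (hcor t) (sq_nonneg ‖Q t‖)
      refine le_trans (le_of_eq ?_) this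
      simp only
      rw [← Finset.mul_sum]
      ring
  rw [integral_sub (integrableOn_cube (by fun_prop)) (integrableOn_cube (by fun_prop)),
    integral_const_mul, integral_const_mul,
    integral_finsetSum _ fun j _ => integrableOn_cube (by fun_prop), hQ,
    integral_norm_sq_centredPoly, ← hQ, ← hT] at hlow
  have hsum : ∑ j, ∫ t in cube m, ‖Q t‖ ^ 2 * (1 - Real.cos (t j - s j)) ≤
      m * (3 ^ m / (2 * M ^ 2) * ((2 * Real.pi) ^ m * T)) := by
    refine (Finset.sum_le_sum fun j _ => integral_tent_kernel_le hM j s).trans (le_of_eq ?_)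
    simp [hT]
  -- The condition `hDM` on `M` is exactly what keeps the penalty below `1/4`, half of the main term
  -- `1/2`.
  have hD' : D * (m * (3 ^ m / (2 * M ^ 2) * ((2 * Real.pi) ^ m * T))) ≤
      1 / 4 * ((2 * Real.pi) ^ m * T) := by
    have h3 : D * (m * (3 ^ m / (2 * M ^ 2))) ≤ (1 / 4 : ℝ) := by
      have : D * (m * (3 ^ m / (2 * M ^ 2))) = (2 * D * m * 3 ^ m) / (4 * (M : ℝ) ^ 2) := by
        field_simp; ring
      rw [this, div_le_iff₀ (by positivity)]
      linarith
    calc _ = D * (m * (3 ^ m / (2 * M ^ 2))) * ((2 * Real.pi) ^ m * T) := by ring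
      _ ≤ _ := by gcongr
  have hfin := (hlow.trans hre).trans hupper
  have := mul_le_mul_of_nonneg_left hsum hD
  refine le_of_mul_le_mul_left ?_ hpi
  linarith

/-- The normalised weights `tent M A * tent M B` form a probability measure, so Jensen passes the
bound on averages to `p`-th powers. For a fixed pair `(A, B)` the map `κ ↦ κ + (B - A)` is
injective, so summing over `F` costs at most the full `l^p` sum, even when neighbourhoods of
different `κ` overlap. -/
lemma card_rpow_le_normA {f : EuclideanSpace ℝ (Fin m) → ℂ} {p : ℝ} (hp : 1 ≤ p)
    (hsum : Summable fun k : Fin m → ℤ => ‖torusCoeff f k‖ ^ p) {M : ℕ} (hM : 1 ≤ M)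
    (F : Finset (Fin m → ℤ))
    (hF : ∀ κ ∈ F, 1 / 4 * ∑ A ∈ tentBox m M, tent M A ^ 2 ≤
      ∑ A ∈ tentBox m M, ∑ B ∈ tentBox m M,
        tent M A * tent M B * ‖torusCoeff f (κ + (B - A))‖) :
    (F.card : ℝ) ^ (1 / p) / (4 * (4 * M + 3) ^ m) ≤ normA p f := by
  set S := tentBox m M with hS
  set T := ∑ A ∈ S, tent M A ^ 2 with hT
  set X := ∑ A ∈ S, tent M A with hX
  have hp0 : 0 < p := by linarith
  have hM' : (0 : ℝ) < M := by exact_mod_cast hM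
  have hT0 : 0 < T := lt_of_lt_of_le (by positivity) (sq_mul_pow_le_sum_tent_sq m M)
  have hXT : X ^ 2 ≤ (4 * M + 3) ^ m * T := by
    have := sq_sum_le_card_mul_sum_sq (s := S) (f := tent M)
    rw [hS, card_tentBox] at this
    exact_mod_cast this
  have hX0 : 0 < X := by
    refine lt_of_le_of_ne (Finset.sum_nonneg fun A _ => tent_nonneg M A) fun h => ?_
    have h1 := (Finset.sum_eq_zero_iff_of_nonneg fun A _ => tent_nonneg M A).1 h.symm
    exact hT0.ne' (Finset.sum_eq_zero fun A hA => by rw [h1 A hA]; norm_num)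
  set w : (Fin m → ℤ) × (Fin m → ℤ) → ℝ := fun q => tent M q.1 * tent M q.2 / X ^ 2 with hw
  have hw0 : ∀ q ∈ S ×ˢ S, 0 ≤ w q := fun q _ =>
    div_nonneg (mul_nonneg (tent_nonneg _ _) (tent_nonneg _ _)) (sq_nonneg _)
  have hw1 : ∑ q ∈ S ×ˢ S, w q = 1 := by
    rw [hw, ← Finset.sum_div, Finset.sum_product, ← Finset.sum_mul_sum, ← hX, ← pow_two,
      div_self (by positivity)]
  set a : ℝ := 1 / (4 * (4 * M + 3) ^ m) with ha
  have ha0 : 0 < a := by positivity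
  have hkey : ∀ κ ∈ F, a ^ p ≤ ∑ q ∈ S ×ˢ S, w q * ‖torusCoeff f (κ + (q.2 - q.1))‖ ^ p := by
    intro κ hκ
    refine le_trans ?_ (Real.rpow_arith_mean_le_arith_mean_rpow (S ×ˢ S) w
      (fun q => ‖torusCoeff f (κ + (q.2 - q.1))‖) hw0 hw1 (fun _ _ => norm_nonneg _) hp)
    refine Real.rpow_le_rpow ha0.le ?_ hp0.le
    have h1 : ∑ q ∈ S ×ˢ S, w q * ‖torusCoeff f (κ + (q.2 - q.1))‖ =
        (∑ A ∈ S, ∑ B ∈ S, tent M A * tent M B * ‖torusCoeff f (κ + (B - A))‖) / X ^ 2 := by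
      rw [Finset.sum_product, Finset.sum_div]
      refine Finset.sum_congr rfl fun A _ => ?_
      rw [Finset.sum_div]
      exact Finset.sum_congr rfl fun B _ => by simp only [hw]; ring
    rw [h1, le_div_iff₀ (by positivity)]
    refine le_trans ?_ (hF κ hκ)
    calc a * X ^ 2 ≤ a * ((4 * M + 3) ^ m * T) := by gcongr
      _ = 1 / 4 * T := by rw [ha]; field_simp
  have htotal : (F.card : ℝ) * a ^ p ≤ ∑' k : Fin m → ℤ, ‖torusCoeff f k‖ ^ p := by
    calc (F.card : ℝ) * a ^ p = ∑ κ ∈ F, a ^ p := by simp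
      _ ≤ ∑ κ ∈ F, ∑ q ∈ S ×ˢ S, w q * ‖torusCoeff f (κ + (q.2 - q.1))‖ ^ p :=
        Finset.sum_le_sum hkey
      _ = ∑ q ∈ S ×ˢ S, w q * ∑ κ ∈ F, ‖torusCoeff f (κ + (q.2 - q.1))‖ ^ p := by
        rw [Finset.sum_comm]
        simp_rw [Finset.mul_sum]
      _ ≤ ∑ q ∈ S ×ˢ S, w q * ∑' k : Fin m → ℤ, ‖torusCoeff f k‖ ^ p := by
        refine Finset.sum_le_sum fun q hq => mul_le_mul_of_nonneg_left ?_ (hw0 q hq)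
        have h2 := hsum.sum_le_tsum (F.map (Equiv.addRight (q.2 - q.1)).toEmbedding)
          fun k _ => Real.rpow_nonneg (norm_nonneg _) p
        simpa using h2
      _ = _ := by rw [← Finset.sum_mul, hw1, one_mul]
  calc (F.card : ℝ) ^ (1 / p) / (4 * (4 * M + 3) ^ m) = ((F.card : ℝ) * a ^ p) ^ (1 / p) := by
        rw [Real.mul_rpow (Nat.cast_nonneg _) (by positivity), ← Real.rpow_mul ha0.le,
          mul_one_div_cancel hp0.ne', Real.rpow_one, ha, mul_one_div]
    _ ≤ normA p f := Real.rpow_le_rpow (by positivity) htotal (by positivity)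

end Kernel

/-! ### Local linearisation of the phase. -/

section Phase

variable {m : ℕ}

lemma TorusPeriodic.lattice {β : Type*} {f : EuclideanSpace ℝ (Fin m) → β}
    (hf : TorusPeriodic f) (n : Fin m → ℤ) :
    Function.Periodic f (∑ j, n j • EuclideanSpace.single j (2 * Real.pi)) := by
  have h : ∀ s : Finset (Fin m),
      Function.Periodic f (∑ j ∈ s, n j • EuclideanSpace.single j (2 * Real.pi)) := by
    intro s
    induction s using Finset.induction_on with
    | empty => intro t; simp
    | insert j s hj ih =>
      rw [Finset.sum_insert hj]
      exact ((hf j).zsmul (n j)).add_period ih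
  exact h _

lemma torusPeriodic_torusChar (k : Fin m → ℤ) :
    TorusPeriodic (torusChar k : EuclideanSpace ℝ (Fin m) → ℂ) := by
  intro j t
  have h : ∑ i, (k i : ℝ) * (t + EuclideanSpace.single j (2 * Real.pi)) i =
      ∑ i, (k i : ℝ) * t i + k j * (2 * Real.pi) := by
    simp [mul_add, Finset.sum_add_distrib]
  rw [torusChar, torusChar, h]
  have h2 : ((∑ i, (k i : ℝ) * t i + k j * (2 * Real.pi) : ℝ) : ℂ) * Complex.I =
      ((∑ i, (k i : ℝ) * t i : ℝ) : ℂ) * Complex.I + k j * (2 * Real.pi * Complex.I) := by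
    push_cast; ring
  rw [h2, Complex.exp_add, Complex.exp_int_mul_two_pi_mul_I, mul_one]

/-- Every displacement is, modulo the period lattice, one with coordinates in `[-π, π]`. -/
lemma exists_lattice_add (t : EuclideanSpace ℝ (Fin m)) :
    ∃ (h : EuclideanSpace ℝ (Fin m)) (n : Fin m → ℤ), (∀ j, |h j| ≤ Real.pi) ∧
      (∀ j, t j = h j + n j * (2 * Real.pi)) ∧
      t = h + ∑ j, n j • EuclideanSpace.single j (2 * Real.pi) := by
  set n : Fin m → ℤ := fun j => round (t j / (2 * Real.pi)) with hn
  have hsum : ∀ j, (∑ i, n i • EuclideanSpace.single i (2 * Real.pi) :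
      EuclideanSpace ℝ (Fin m)) j = n j * (2 * Real.pi) := by
    intro j
    simp [Pi.single_apply]
  refine ⟨t - ∑ j, n j • EuclideanSpace.single j (2 * Real.pi), n, fun j => ?_, fun j => ?_,
    (sub_add_cancel _ _).symm⟩
  · rw [PiLp.sub_apply, hsum]
    have h1 := abs_sub_round (t j / (2 * Real.pi))
    have h2 : t j - n j * (2 * Real.pi) =
        (t j / (2 * Real.pi) - round (t j / (2 * Real.pi))) * (2 * Real.pi) := by
      rw [sub_mul, div_mul_cancel₀ _ Real.two_pi_pos.ne']
    rw [h2, abs_mul, abs_of_pos Real.two_pi_pos]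
    nlinarith [Real.pi_pos]
  · rw [PiLp.sub_apply, hsum, sub_add_cancel]

lemma norm_le_of_forall_abs_le {h : EuclideanSpace ℝ (Fin m)} {d : ℝ} (hd : ∀ j, |h j| ≤ d) :
    ‖h‖ ≤ m * d := by
  have h1 : h = ∑ j, EuclideanSpace.single j (h j) := by
    ext i
    simp [Pi.single_apply]
  rw [h1]
  refine (norm_sum_le _ _).trans ((Finset.sum_le_sum fun j _ => ?_).trans
    (le_of_eq (by simp : ∑ _ : Fin m, d = m * d)))
  simpa using hd j

/-- Mean value inequality on the closed ball of radius `‖h‖` about `s`, where the gradient differs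
from its value at `s` by `O(‖h‖ ^ α)`. -/
lemma C1Alpha.exists_taylor {α : ℝ} {φ : EuclideanSpace ℝ (Fin m) → ℝ}
    (hφ : C1Alpha α φ) :
    ∃ C δ₀ : ℝ, 0 < C ∧ 0 < δ₀ ∧ ∀ s h : EuclideanSpace ℝ (Fin m), ‖h‖ ≤ δ₀ →
      |φ (s + h) - φ s - ∑ j, (∇ φ) s j * h j| ≤ C * ‖h‖ ^ (1 + α) := by
  obtain ⟨C, δ₀, hδ₀, hC⟩ := hφ.gradient_lip
  refine ⟨max C 1, δ₀, by positivity, hδ₀, fun s h hh => ?_⟩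
  rcases eq_or_ne h 0 with rfl | hne
  · simp only [add_zero, sub_self, PiLp.zero_apply, mul_zero, Finset.sum_const_zero, abs_zero]
    positivity
  have hpos : 0 < ‖h‖ := norm_pos_iff.2 hne
  have key := (convex_closedBall s ‖h‖).norm_image_sub_le_of_norm_hasFDerivWithin_le'
    (f := φ) (f' := fun x => InnerProductSpace.toDual ℝ _ ((∇ φ) x))
    (φ := InnerProductSpace.toDual ℝ _ ((∇ φ) s)) (C := C * ‖h‖ ^ α) (x := s) (y := s + h)
    (fun x _ => (hφ.differentiable x).hasGradientAt.hasFDerivAt.hasFDerivWithinAt)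
    (fun x hx => by
      rw [← map_sub, LinearIsometryEquiv.norm_map]
      exact hC ‖h‖ hpos hh x s (mem_closedBall_iff_norm.1 hx))
    (Metric.mem_closedBall_self hpos.le) (by simp)
  rw [add_sub_cancel_left, InnerProductSpace.toDual_apply_apply, Real.norm_eq_abs,
    PiLp.inner_apply] at key
  have hin : ∑ j, inner ℝ ((∇ φ) s j) (h j) = ∑ j, (∇ φ) s j * h j :=
    Finset.sum_congr rfl fun j _ => by simp [mul_comm]
  rw [hin] at key
  refine key.trans ?_
  rw [mul_assoc, Real.rpow_add hpos, Real.rpow_one, mul_comm (‖h‖ ^ α)]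
  gcongr
  exact le_max_left _ _

lemma continuous_expPhase {φ : EuclideanSpace ℝ (Fin m) → ℝ} (hφ : Continuous φ) (lam : ℝ) :
    Continuous (expPhase φ lam) := by
  unfold expPhase
  fun_prop

/-- The phase factor normalising `e^{iλφ} e^{-i(κ,·)}` at the point `s`. -/
def phaseFactor (φ : EuclideanSpace ℝ (Fin m) → ℝ) (lam : ℝ) (κ : Fin m → ℤ)
    (s : EuclideanSpace ℝ (Fin m)) : ℂ :=
  Complex.exp (((∑ j, (κ j : ℝ) * s j - lam * φ s : ℝ) : ℂ) * Complex.I)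

lemma phaseFactor_mul_re (φ : EuclideanSpace ℝ (Fin m) → ℝ) (lam : ℝ) (κ : Fin m → ℤ)
    (s h : EuclideanSpace ℝ (Fin m)) :
    (phaseFactor φ lam κ s * (expPhase φ lam (s + h) * torusChar (-κ) (s + h))).re =
      Real.cos (lam * (φ (s + h) - φ s) - ∑ j, (κ j : ℝ) * h j) := by
  rw [← Complex.exp_ofReal_mul_I_re, phaseFactor, expPhase, torusChar, ← Complex.exp_add,
    ← Complex.exp_add]
  congr 2
  have h1 : ∑ j, (((-κ) j : ℤ) : ℝ) * (s + h) j =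
      -∑ j, (κ j : ℝ) * s j - ∑ j, (κ j : ℝ) * h j := by
    simp [mul_add, Finset.sum_add_distrib]
    ring
  rw [h1]
  push_cast
  ring

/-- Near `s`, the Taylor error and the rounding error of `κ` are each at most `1/2`, so the phase is
at most `1` in absolute value and its cosine at least `1/2`. Away from `s` modulo periods, some
displacement coordinate lies between `d` and `π` in absolute value, so the penalty is at least `2`
and the left side drops below `-1`. -/
lemma correlation_of_taylor {φ : EuclideanSpace ℝ (Fin m) → ℝ} (hper : TorusPeriodic φ)
    {α C δ₀ : ℝ} (hC : 0 < C) (hα : 0 < α)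
    (htaylor : ∀ s h : EuclideanSpace ℝ (Fin m), ‖h‖ ≤ δ₀ →
      |φ (s + h) - φ s - ∑ j, (∇ φ) s j * h j| ≤ C * ‖h‖ ^ (1 + α))
    {lam : ℝ} {κ : Fin m → ℤ} {s : EuclideanSpace ℝ (Fin m)}
    (hκ : ∀ j, |(κ j : ℝ) - lam * (∇ φ) s j| ≤ 1 / 2) {d : ℝ} (hd : 0 < d) (hd1 : m * d ≤ 1)
    (hdδ : m * d ≤ δ₀) (hdC : |lam| * (C * (m * d) ^ (1 + α)) ≤ 1 / 2)
    (t : EuclideanSpace ℝ (Fin m)) :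
    1 / 2 - Real.pi ^ 2 / d ^ 2 * ∑ j, (1 - Real.cos (t j - s j)) ≤
      (phaseFactor φ lam κ s * (expPhase φ lam t * torusChar (-κ) t)).re := by
  obtain ⟨h, n, hh, hcoord, hvec⟩ := exists_lattice_add (t - s)
  have hcos : ∀ j, Real.cos (t j - s j) = Real.cos (h j) := fun j => by
    rw [← PiLp.sub_apply, hcoord, Real.cos_add_int_mul_two_pi]
  have ht : t = s + h + ∑ j, n j • EuclideanSpace.single j (2 * Real.pi) := by
    rw [add_assoc, ← hvec, add_sub_cancel]
  have he : expPhase φ lam t = expPhase φ lam (s + h) := by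
    rw [expPhase, expPhase, ht, hper.lattice n]
  have hc : torusChar (-κ) t = torusChar (-κ) (s + h) := by
    rw [ht, (torusPeriodic_torusChar (-κ)).lattice n]
  rw [he, hc, phaseFactor_mul_re]
  simp_rw [hcos]
  have hnn : ∀ j ∈ Finset.univ, 0 ≤ 1 - Real.cos (h j) := fun j _ => by
    linarith [Real.cos_le_one (h j)]
  by_cases hnear : ∀ j, |h j| ≤ d
  · have hnorm := norm_le_of_forall_abs_le hnear
    have h1 : |lam * (φ (s + h) - φ s - ∑ j, (∇ φ) s j * h j)| ≤ 1 / 2 := by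
      rw [abs_mul]
      refine le_trans ?_ hdC
      gcongr
      exact (htaylor s h (hnorm.trans hdδ)).trans (by gcongr)
    have h2 : |∑ j, ((κ j : ℝ) - lam * (∇ φ) s j) * h j| ≤ 1 / 2 := by
      refine (Finset.abs_sum_le_sum_abs _ _).trans ?_
      have : ∀ j ∈ Finset.univ, |((κ j : ℝ) - lam * (∇ φ) s j) * h j| ≤ 1 / 2 * d := fun j _ => by
        rw [abs_mul]
        exact mul_le_mul (hκ j) (hnear j) (abs_nonneg _) (by norm_num)
      refine (Finset.sum_le_sum this).trans ?_
      simp only [Finset.sum_const, Finset.card_univ, Fintype.card_fin, nsmul_eq_mul]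
      linarith
    have h3 : lam * (φ (s + h) - φ s) - ∑ j, (κ j : ℝ) * h j =
        lam * (φ (s + h) - φ s - ∑ j, (∇ φ) s j * h j) -
          ∑ j, ((κ j : ℝ) - lam * (∇ φ) s j) * h j := by
      have : ∑ j, ((κ j : ℝ) - lam * (∇ φ) s j) * h j =
          ∑ j, (κ j : ℝ) * h j - lam * ∑ j, (∇ φ) s j * h j := by
        rw [Finset.mul_sum, ← Finset.sum_sub_distrib]
        exact Finset.sum_congr rfl fun j _ => by ring
      rw [this]
      ring
    rw [h3]
    set x := lam * (φ (s + h) - φ s - ∑ j, (∇ φ) s j * h j) -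
      ∑ j, ((κ j : ℝ) - lam * (∇ φ) s j) * h j
    have hx : |x| ≤ 1 := (abs_sub _ _).trans (by linarith)
    have hx2 := (sq_le_one_iff_abs_le_one _).2 hx
    have := Real.one_sub_sq_div_two_le_cos (x := x)
    have hpos : 0 ≤ Real.pi ^ 2 / d ^ 2 * ∑ j, (1 - Real.cos (h j)) :=
      mul_nonneg (by positivity) (Finset.sum_nonneg hnn)
    linarith
  · push Not at hnear
    obtain ⟨j, hj⟩ := hnear
    have h1 := Real.cos_le_one_sub_mul_cos_sq (hh j)
    have h2 : d ^ 2 ≤ h j ^ 2 := by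
      rw [← sq_abs (h j)]
      gcongr
    have h3 : 2 / Real.pi ^ 2 * d ^ 2 ≤ 1 - Real.cos (h j) := by
      have : 2 / Real.pi ^ 2 * d ^ 2 ≤ 2 / Real.pi ^ 2 * h j ^ 2 := by gcongr
      linarith
    have h4 : 2 ≤ Real.pi ^ 2 / d ^ 2 * ∑ j, (1 - Real.cos (h j)) := by
      calc (2 : ℝ) = Real.pi ^ 2 / d ^ 2 * (2 / Real.pi ^ 2 * d ^ 2) := by
            field_simp
        _ ≤ _ := by
          gcongr
          exact h3.trans (Finset.single_le_sum hnn (Finset.mem_univ j))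
    linarith [Real.neg_one_le_cos (lam * (φ (s + h) - φ s) - ∑ j, (κ j : ℝ) * h j)]

/-- The lattice points within `1/2`, in each coordinate, of the range of `λ∇φ`. -/
def nearGradient (φ : EuclideanSpace ℝ (Fin m) → ℝ) (lam : ℝ) : Set (Fin m → ℤ) :=
  {κ | ∃ s, ∀ j, |(κ j : ℝ) - lam * (∇ φ) s j| ≤ 1 / 2}

lemma exists_normA_ge_card (hm : 1 ≤ m) {α : ℝ} (hα : 0 < α)
    {φ : EuclideanSpace ℝ (Fin m) → ℝ} (hφ : C1Alpha α φ) :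
    ∃ c : ℝ, 0 < c ∧ ∀ p : ℝ, 1 ≤ p → ∀ lam ∈ Lam φ p, ∀ F : Finset (Fin m → ℤ),
      (F : Set (Fin m → ℤ)) ⊆ nearGradient φ lam →
        c * (F.card : ℝ) ^ (1 / p) * (max 1 |lam|) ^ (-(m / (1 + α))) ≤
          normA p (expPhase φ lam) := by
  obtain ⟨C, δ₀, hC, hδ₀, htaylor⟩ := hφ.exists_taylor
  have hm' : (1 : ℝ) ≤ m := by exact_mod_cast hm
  have hm0 : (0 : ℝ) < m := by linarith
  have hα' : 0 < 1 + α := by linarith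
  -- With `m * d ≤ b`, the three terms of the minimum control, in order, the rounding error, the
  -- range of validity of the Taylor bound, and the Taylor error.
  set b : ℝ := min (min 1 δ₀) ((1 / (2 * C)) ^ (1 / (1 + α))) with hb
  have hb0 : 0 < b := by positivity
  -- For `D = π² / d²` the requirement on `M` reads `B / d² ≤ M²`. As `B ≥ 1`, the choice `M = ⌈B /
  -- d⌉` suffices.
  set B : ℝ := 2 * Real.pi ^ 2 * m * 3 ^ m with hB
  have hB1 : 1 ≤ B := by
    have h3 : (1 : ℝ) ≤ 3 ^ m := one_le_pow₀ (by norm_num)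
    have hpi : 1 ≤ Real.pi ^ 2 := one_le_pow₀ (by linarith [Real.pi_gt_three])
    have : 1 ≤ Real.pi ^ 2 * m * 3 ^ m :=
      one_le_mul_of_one_le_of_one_le (one_le_mul_of_one_le_of_one_le hpi hm') h3
    rw [hB]
    linarith
  refine ⟨(b / m) ^ m / (4 * (4 * B + 7) ^ m), by positivity, fun p hp lam hlam F hF => ?_⟩
  set r := max 1 |lam| with hr
  have hr1 : 1 ≤ r := le_max_left _ _
  have hr0 : 0 < r := by linarith
  set d := b / m * r ^ (-(1 / (1 + α))) with hd
  have hd0 : 0 < d := by positivity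
  have hrle : r ^ (-(1 / (1 + α))) ≤ 1 :=
    Real.rpow_le_one_of_one_le_of_nonpos hr1 (by rw [neg_nonpos]; positivity)
  have hmd : m * d = b * r ^ (-(1 / (1 + α))) := by rw [hd]; field_simp
  have hmdb : m * d ≤ b := by
    rw [hmd]
    exact mul_le_of_le_one_right hb0.le hrle
  have hd1 : m * d ≤ 1 := hmdb.trans ((min_le_left _ _).trans (min_le_left _ _))
  have hdle : d ≤ 1 := le_trans (le_mul_of_one_le_left hd0.le hm') hd1
  have hdδ : m * d ≤ δ₀ := hmdb.trans ((min_le_left _ _).trans (min_le_right _ _))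
  have hdC : |lam| * (C * (m * d) ^ (1 + α)) ≤ 1 / 2 := by
    have h1 : (m * d) ^ (1 + α) = b ^ (1 + α) * r⁻¹ := by
      rw [hmd, Real.mul_rpow hb0.le (by positivity), ← Real.rpow_mul hr0.le, neg_mul,
        one_div_mul_cancel hα'.ne', Real.rpow_neg_one]
    have h2 : b ^ (1 + α) ≤ 1 / (2 * C) := by
      calc b ^ (1 + α) ≤ ((1 / (2 * C)) ^ (1 / (1 + α))) ^ (1 + α) := by
            gcongr
            exact min_le_right _ _
        _ = 1 / (2 * C) := by
          rw [← Real.rpow_mul (by positivity), one_div_mul_cancel hα'.ne', Real.rpow_one]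
    have h3 : |lam| * r⁻¹ ≤ 1 := by
      rw [← div_eq_mul_inv, div_le_one hr0]
      exact le_max_right _ _
    calc |lam| * (C * (m * d) ^ (1 + α)) = (|lam| * r⁻¹) * (C * b ^ (1 + α)) := by rw [h1]; ring
      _ ≤ 1 * (C * (1 / (2 * C))) := by gcongr
      _ = 1 / 2 := by field_simp
  set M := ⌈B / d⌉₊ with hM
  have hMge : B / d ≤ M := Nat.le_ceil _
  have hM1 : 1 ≤ M := Nat.one_le_ceil_iff.2 (by positivity)
  have hDM : 2 * (Real.pi ^ 2 / d ^ 2) * m * 3 ^ m ≤ (M : ℝ) ^ 2 := by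
    calc 2 * (Real.pi ^ 2 / d ^ 2) * m * 3 ^ m = B * 1 / d ^ 2 := by rw [hB]; ring
      _ ≤ B * B / d ^ 2 := by gcongr
      _ = (B / d) ^ 2 := by ring
      _ ≤ _ := by gcongr
  -- Rounding up gives `4M + 3 < 4B/d + 7`, and `d ≤ 1` absorbs the `7`.
  have hM4 : (4 * M + 3 : ℝ) ≤ (4 * B + 7) / d := by
    have h1 : (M : ℝ) < B / d + 1 := Nat.ceil_lt_add_one (by positivity)
    have h2 : 7 ≤ 7 / d := by rw [le_div_iff₀ hd0]; linarith
    have h3 : (4 * B + 7) / d = 4 * (B / d) + 7 / d := by ring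
    linarith
  have hcard := card_rpow_le_normA hp hlam.summable hM1 F fun κ hκ => by
    obtain ⟨s, hs⟩ := hF hκ
    exact sum_tent_sq_le_of_correlation (continuous_expPhase hφ.differentiable.continuous lam)
      (Complex.norm_exp_ofReal_mul_I _) (by positivity)
      (correlation_of_taylor hφ.periodic hC hα htaylor hs hd0 hd1 hdδ hdC) hM1 hDM
  refine le_trans ?_ hcard
  have hdm : d ^ m = (b / m) ^ m * r ^ (-(m / (1 + α))) := by
    rw [hd, mul_pow, ← Real.rpow_mul_natCast hr0.le]
    congr 2
    ring
  calc _ = (F.card : ℝ) ^ (1 / p) / (4 * ((4 * B + 7) / d) ^ m) := by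
        rw [div_pow (4 * B + 7) d m, hdm]
        field_simp
    _ ≤ _ := by gcongr

/-! ### Counting lattice points near the range of the scaled gradient. -/

lemma volume_unitCube (κ : Fin m → ℤ) :
    volume {u : EuclideanSpace ℝ (Fin m) | ∀ j, |(κ j : ℝ) - u j| ≤ 1 / 2} = 1 := by
  have h : {u : EuclideanSpace ℝ (Fin m) | ∀ j, |(κ j : ℝ) - u j| ≤ 1 / 2} =
      (WithLp.ofLp : EuclideanSpace ℝ (Fin m) → Fin m → ℝ) ⁻¹'
        Set.Icc (fun j => κ j - 1 / 2) (fun j => κ j + 1 / 2) := by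
    ext u
    simp only [Set.mem_ofPred_eq, Set.mem_preimage, Set.mem_Icc, Pi.le_def, ← forall_and]
    refine forall_congr' fun j => ?_
    rw [abs_le]
    constructor <;> rintro ⟨h1, h2⟩ <;> constructor <;> linarith
  rw [h, (PiLp.volume_preserving_ofLp (Fin m)).measure_preimage
    measurableSet_Icc.nullMeasurableSet, Real.volume_Icc_pi]
  simp
  norm_num

open scoped Pointwise in
/-- The number of lattice points near the range of `λ∇φ` is at least of order
`max(1, |λ|)^m` when the gradient is nondegenerate. -/
lemma NondegenerateGradient.exists_card_ge {φ : EuclideanSpace ℝ (Fin m) → ℝ}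
    (hφ : NondegenerateGradient φ) :
    ∃ c : ℝ, 0 < c ∧ ∀ lam X : ℝ, (∀ F : Finset (Fin m → ℤ),
      (F : Set (Fin m → ℤ)) ⊆ nearGradient φ lam → (F.card : ℝ) ≤ X) →
        c * (max 1 |lam|) ^ m ≤ X := by
  -- The cap at `1` keeps `v` finite, and for `|λ| ≤ 1` it lets a single lattice point suffice.
  set v := min 1 (volume (Set.range (∇ φ))) with hv
  have hv0 : v ≠ 0 := (lt_min zero_lt_one hφ).ne'
  have hv1 : v ≤ 1 := min_le_left _ _
  have hvt : v ≠ ⊤ := ne_top_of_le_ne_top ENNReal.one_ne_top hv1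
  refine ⟨v.toReal, ENNReal.toReal_pos hv0 hvt, fun lam X hX => ?_⟩
  have hround : ∀ s : EuclideanSpace ℝ (Fin m),
      (fun j => round (lam * (∇ φ) s j)) ∈ nearGradient φ lam := fun s =>
    ⟨s, fun j => by rw [abs_sub_comm]; exact abs_sub_round _⟩
  rcases le_total |lam| 1 with hlam | hlam
  · have h1 := hX {fun j => round (lam * (∇ φ) 0 j)} (by simpa using hround 0)
    rw [max_eq_left hlam, one_pow, mul_one]
    have h2 : v.toReal ≤ 1 := ENNReal.toReal_le_of_le_ofReal zero_le_one (by simpa using hv1)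
    simp only [Finset.card_singleton, Nat.cast_one] at h1
    linarith
  -- A uniform bound `X` on finite subsets forces finiteness, so the whole set can be used in the
  -- covering.
  · have hfin : (nearGradient φ lam).Finite := by
      by_contra hinf
      obtain ⟨F, hF, hcard⟩ := Set.Infinite.exists_subset_card_eq hinf (⌊X⌋₊ + 1)
      have h1 := hX F hF
      rw [hcard] at h1
      push_cast at h1
      linarith [Nat.lt_floor_add_one X]
    have hF := hX hfin.toFinset (by simp)
    have hcover : lam • Set.range (∇ φ) ⊆ ⋃ κ ∈ hfin.toFinset,
        {u : EuclideanSpace ℝ (Fin m) | ∀ j, |(κ j : ℝ) - u j| ≤ 1 / 2} := by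
      rintro _ ⟨_, ⟨s, rfl⟩, rfl⟩
      refine Set.mem_iUnion₂.2 ⟨_, hfin.mem_toFinset.2 (hround s), fun j => ?_⟩
      rw [abs_sub_comm]
      exact abs_sub_round _
    have hvol := (measure_mono (μ := volume) hcover).trans (measure_biUnion_finset_le _ _)
    simp only [volume_unitCube, Finset.sum_const, nsmul_eq_mul, mul_one] at hvol
    rw [Measure.addHaar_smul, finrank_euclideanSpace, Fintype.card_fin, abs_pow] at hvol
    have h2 : ENNReal.ofReal (|lam| ^ m) * v ≤ (hfin.toFinset.card : ENNReal) :=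
      le_trans (by gcongr; exact min_le_right _ _) hvol
    have h3 := ENNReal.toReal_mono (ENNReal.natCast_ne_top _) h2
    rw [ENNReal.toReal_mul, ENNReal.toReal_ofReal (by positivity), ENNReal.toReal_natCast] at h3
    rw [max_eq_right hlam]
    linarith

/-! ### Combining the norm bound with the count. -/

lemma exists_normA_ge (hm : 1 ≤ m) {α : ℝ} (hα : 0 < α) {φ : EuclideanSpace ℝ (Fin m) → ℝ}
    (hφ : C1Alpha α φ) (hgrad : NondegenerateGradient φ) {p : ℝ} (hp : 1 ≤ p)
    (hpα : p < 1 + α) :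
    ∃ c : ℝ, 0 < c ∧ ∀ lam ∈ Lam φ p,
      c * |lam| ^ ((m : ℝ) * (1 / p - 1 / (1 + α))) ≤ normA p (expPhase φ lam) := by
  obtain ⟨c₁, hc₁, h₁⟩ := exists_normA_ge_card hm hα hφ
  obtain ⟨c₂, hc₂, h₂⟩ := hgrad.exists_card_ge
  have hp0 : 0 < p := by linarith
  refine ⟨c₁ * c₂ ^ (1 / p), by positivity, fun lam hlam => ?_⟩
  set r := max 1 |lam| with hr
  have hr0 : 0 < r := lt_of_lt_of_le one_pos (le_max_left _ _)
  set N := normA p (expPhase φ lam) with hN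
  have hN0 : 0 ≤ N := by
    rw [hN, normA]
    exact Real.rpow_nonneg (tsum_nonneg fun k => Real.rpow_nonneg (norm_nonneg _) _) _
  set y := c₁ * r ^ (-((m : ℝ) / (1 + α))) with hy
  have hy0 : 0 < y := by positivity
  -- The norm bound, solved for `F.card`, is an upper bound independent of `F`; this is the `X` of
  -- the counting lemma.
  have hcount := h₂ lam ((N / y) ^ p) fun F hF => by
    have h3 := h₁ p hp lam hlam F hF
    have h4 : (F.card : ℝ) ^ (1 / p) ≤ N / y := by
      rw [le_div_iff₀ hy0, hy]
      calc _ = c₁ * (F.card : ℝ) ^ (1 / p) * r ^ (-((m : ℝ) / (1 + α))) := by ring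
        _ ≤ N := h3
    calc (F.card : ℝ) = ((F.card : ℝ) ^ (1 / p)) ^ p := by
          rw [← Real.rpow_mul (Nat.cast_nonneg _), one_div_mul_cancel hp0.ne', Real.rpow_one]
      _ ≤ _ := by gcongr
  have hroot : (c₂ * r ^ m) ^ (1 / p) ≤ N / y := by
    calc (c₂ * r ^ m) ^ (1 / p) ≤ ((N / y) ^ p) ^ (1 / p) := by gcongr
      _ = N / y := by
        rw [← Real.rpow_mul (by positivity), mul_one_div_cancel hp0.ne', Real.rpow_one]
  rw [le_div_iff₀ hy0, Real.mul_rpow hc₂.le (by positivity), ← Real.rpow_natCast,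
    ← Real.rpow_mul hr0.le] at hroot
  -- Here `p < 1 + α` enters: a nonnegative exponent allows `r` to be replaced by the smaller `|λ|`.
  have hexp : 0 ≤ (m : ℝ) * (1 / p - 1 / (1 + α)) :=
    mul_nonneg (Nat.cast_nonneg _) (sub_nonneg.2 (one_div_le_one_div_of_le hp0 hpα.le))
  calc c₁ * c₂ ^ (1 / p) * |lam| ^ ((m : ℝ) * (1 / p - 1 / (1 + α)))
      ≤ c₁ * c₂ ^ (1 / p) * r ^ ((m : ℝ) * (1 / p - 1 / (1 + α))) := by
        gcongr
        exact le_max_right _ _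
    _ = c₂ ^ (1 / p) * r ^ ((m : ℝ) * (1 / p)) * y := by
        rw [hy, show (m : ℝ) * (1 / p - 1 / (1 + α)) = m * (1 / p) + -(m / (1 + α)) by ring,
          Real.rpow_add hr0]
        ring
    _ ≤ N := hroot

end Phase

end BeurlingHelson

end

theorem corollary1 (m : ℕ) (hm : 1 ≤ m) (α : ℝ) (hα0 : 0 < α) (hα1 : α ≤ 1)
    (φ : EuclideanSpace ℝ (Fin m) → ℝ) (hφ : BeurlingHelson.C1Alpha α φ)
    (hgrad : BeurlingHelson.NondegenerateGradient φ) :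
    (∀ p : ℝ, 1 ≤ p → p < 1 + α →
      ∃ c : ℝ, 0 < c ∧ ∀ lam ∈ BeurlingHelson.Lam φ p,
        c * |lam| ^ ((m : ℝ) * (1 / p - 1 / (1 + α))) ≤
          BeurlingHelson.normA p (BeurlingHelson.expPhase φ lam)) ∧
    (∃ c : ℝ, 0 < c ∧ ∀ lam ∈ BeurlingHelson.Lam φ 1,
      c * |lam| ^ ((m : ℝ) * α / (1 + α)) ≤
        BeurlingHelson.normA 1 (BeurlingHelson.expPhase φ lam)) := by
  refine ⟨fun p hp hpα => BeurlingHelson.exists_normA_ge hm hα0 hφ hgrad hp hpα, ?_⟩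
  have h := BeurlingHelson.exists_normA_ge hm hα0 hφ hgrad le_rfl (by linarith : 1 < 1 + α)
  have hexp : (m : ℝ) * (1 / 1 - 1 / (1 + α)) = m * α / (1 + α) := by
    field_simp
    ring
  rwa [hexp] at h
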